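/- For a nonempty open set $\Omega\subseteq\mathbb{C}$ let $\mathcal{A}(\Omega)$ be the set of complex analytic functions on $\Omega$, with pointwise addition, the bracket $[f,g]=fg'-f'g$, and the compact-open topology (uniform convergence on compact subsets of $\Omega$). A Polish Lie ring is a Lie ring equipped with a Polish (separable, completely metrizable) topology for which the additive group operations and the bracket are continuous. A Polish Lie ring $\mathcal{R}$ is algebraically determined if, for every Polish Lie ring $\mathcal{L}$, every abstract Lie ring isomorphism $\varphi:\mathcal{L}\to\mathcal{R}$ is a homeomorphism. Theorem. Let $\Omega\subsetneq\mathbb{C}$ be a nonempty open, connected and simply connected set. Then $\mathcal{A}(\Omega)$ is a Polish Lie ring and it is algebraically determined. In particular, for the open unit disk $\mathbb{D}=\{z\in\mathbb{C}: |z|<1\}$, $\mathcal{A}(\mathbb{D})$ is an algebraically determined Polish Lie ring. -/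

import Mathlib

open TopologicalSpace

universe u v

/-- A Polish Lie ring: a Lie ring with a Polish (separable, completely metrizable) topology for which
addition, negation and the Lie bracket are continuous. -/
class IsPolishLieRing (L : Type v) [LieRing L] [TopologicalSpace L] : Prop extends
    PolishSpace L, IsTopologicalAddGroup L where
  continuous_bracket : Continuous fun p : L × L => ⁅p.1, p.2⁆

/-- `L` is an algebraically determined Polish Lie ring: it is a Polish Lie ring, and every abstract
isomorphism of Lie rings (that is, of Lie algebras over `ℤ`) from a Polish Lie ring onto `L` is a
homeomorphism. -/
structure IsAlgebraicallyDeterminedPolishLieRing (L : Type v) [LieRing L] [TopologicalSpace L] :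
    Prop where
  isPolishLieRing : IsPolishLieRing L
  isHomeomorph : ∀ (S : Type u) [LieRing S] [TopologicalSpace S] [IsPolishLieRing S]
    (φ : S ≃ₗ⁅ℤ⁆ L), IsHomeomorph φ

namespace AnalyticFunctions

/-- Extension by zero of a function on `Ω` to all of `ℂ`; only its values on the open set `Ω` are
ever used. -/
noncomputable def extendZero (Ω : Opens ℂ) (f : Ω → ℂ) : ℂ → ℂ :=
  Function.extend Subtype.val f 0

theorem extendZero_apply {Ω : Opens ℂ} (f : Ω → ℂ) (z : Ω) : extendZero Ω f z = f z :=
  Subtype.val_injective.extend_apply f 0 z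

theorem extendZero_eventuallyEq {Ω : Opens ℂ} {f : Ω → ℂ} {F : ℂ → ℂ} (h : ∀ z : Ω, f z = F z)
    (z : Ω) : extendZero Ω f =ᶠ[nhds (z : ℂ)] F := by
  filter_upwards [Ω.isOpen.mem_nhds z.2] with w hw
  exact (extendZero_apply f ⟨w, hw⟩).trans (h ⟨w, hw⟩)

/-- The algebra of complex analytic functions on `Ω`, inside the continuous functions `C(Ω, ℂ)` with
their compact-open topology. -/
noncomputable def analyticSubalgebra (Ω : Opens ℂ) : Subalgebra ℂ C(Ω, ℂ) where
  carrier := {f | AnalyticOnNhd ℂ (extendZero Ω f) Ω}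
  mul_mem' {f g} hf hg z hz :=
    ((hf z hz).mul (hg z hz)).congr (extendZero_eventuallyEq (fun w => by
      simp [extendZero_apply]) ⟨z, hz⟩).symm
  add_mem' {f g} hf hg z hz :=
    ((hf z hz).add (hg z hz)).congr (extendZero_eventuallyEq (fun w => by
      simp [extendZero_apply]) ⟨z, hz⟩).symm
  algebraMap_mem' c z hz :=
    (analyticAt_const (v := c)).congr (extendZero_eventuallyEq (fun w => by
      simp) ⟨z, hz⟩).symm

/-- The derivative `f ↦ f'` on the analytic functions on `Ω`. -/
noncomputable def derivative {Ω : Opens ℂ} (f : analyticSubalgebra Ω) : analyticSubalgebra Ω :=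
  ⟨⟨fun z => deriv (extendZero Ω f.1) z, continuous_iff_continuousAt.2 fun z =>
      (f.2 z z.2).deriv.continuousAt.comp continuous_subtype_val.continuousAt⟩,
    fun z hz => (f.2 z hz).deriv.congr (extendZero_eventuallyEq (fun _ => rfl) ⟨z, hz⟩).symm⟩

theorem derivative_add {Ω : Opens ℂ} (f g : analyticSubalgebra Ω) :
    derivative (f + g) = derivative f + derivative g := by
  ext z
  change deriv (extendZero Ω (f.1 + g.1)) z =
    deriv (extendZero Ω f.1) z + deriv (extendZero Ω g.1) z
  rw [(extendZero_eventuallyEq (F := extendZero Ω f.1 + extendZero Ω g.1)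
    (fun w => by simp [extendZero_apply]) z).deriv_eq]
  exact deriv_add (f.2 z z.2).differentiableAt (g.2 z z.2).differentiableAt

theorem derivative_mul {Ω : Opens ℂ} (f g : analyticSubalgebra Ω) :
    derivative (f * g) = derivative f * g + f * derivative g := by
  ext z
  change deriv (extendZero Ω (f.1 * g.1)) z =
    deriv (extendZero Ω f.1) z * g.1 z + f.1 z * deriv (extendZero Ω g.1) z
  rw [(extendZero_eventuallyEq (F := extendZero Ω f.1 * extendZero Ω g.1)
    (fun w => by simp [extendZero_apply]) z).deriv_eq,
    deriv_mul (f.2 z z.2).differentiableAt (g.2 z z.2).differentiableAt,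
    extendZero_apply, extendZero_apply]

theorem derivative_sub {Ω : Opens ℂ} (f g : analyticSubalgebra Ω) :
    derivative (f - g) = derivative f - derivative g := by
  have h := derivative_add (f - g) g
  rw [show f - g + g = f by ring] at h
  rw [h]; ring

/-- The bracket `[f, g] = f g' - f' g`. -/
noncomputable def bracket {Ω : Opens ℂ} (f g : analyticSubalgebra Ω) : analyticSubalgebra Ω :=
  f * derivative g - derivative f * g

theorem bracket_add_left {Ω : Opens ℂ} (f g h : analyticSubalgebra Ω) :
    bracket (f + g) h = bracket f h + bracket g h := by
  simp only [bracket, derivative_add]; ring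

theorem bracket_add_right {Ω : Opens ℂ} (f g h : analyticSubalgebra Ω) :
    bracket f (g + h) = bracket f g + bracket f h := by
  simp only [bracket, derivative_add]; ring

theorem bracket_self {Ω : Opens ℂ} (f : analyticSubalgebra Ω) : bracket f f = 0 := by
  simp only [bracket]; ring

theorem bracket_leibniz {Ω : Opens ℂ} (f g h : analyticSubalgebra Ω) :
    bracket f (bracket g h) = bracket (bracket f g) h + bracket g (bracket f h) := by
  simp only [bracket, derivative_sub, derivative_mul]; ring

end AnalyticFunctions

open AnalyticFunctions in
/-- `𝒜(Ω)`: the complex analytic functions on `Ω` with pointwise addition, the compact-open topology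
and the bracket `⁅f, g⁆ = f g' - f' g`. It is a separate type so that the bracket does not clash with
the (trivial) commutator bracket of the commutative ring of analytic functions. -/
def AnalyticLieRing (Ω : Opens ℂ) : Type := analyticSubalgebra Ω

namespace AnalyticLieRing

open AnalyticFunctions

noncomputable instance (Ω : Opens ℂ) : AddCommGroup (AnalyticLieRing Ω) :=
  inferInstanceAs (AddCommGroup (analyticSubalgebra Ω))

instance (Ω : Opens ℂ) : TopologicalSpace (AnalyticLieRing Ω) :=
  inferInstanceAs (TopologicalSpace (analyticSubalgebra Ω))

noncomputable instance (Ω : Opens ℂ) : LieRing (AnalyticLieRing Ω) where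
  bracket := bracket (Ω := Ω)
  add_lie := bracket_add_left (Ω := Ω)
  lie_add := bracket_add_right (Ω := Ω)
  lie_self := bracket_self (Ω := Ω)
  leibniz_lie := bracket_leibniz (Ω := Ω)

end AnalyticLieRing

/-- The open unit disk in `ℂ`. -/
def unitDisk : Opens ℂ := ⟨Metric.ball 0 1, Metric.isOpen_ball⟩

/-! Transport the topology of a Polish Lie ring `S` along the isomorphism to the algebra `A` of
analytic functions. Only addition and the bracket are then known to be continuous; multiplication
and complex scalars are not. It suffices to show that every point evaluation is continuous: the
graph of the isomorphism is then closed, and the closed graph and open mapping theorems for Polish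
abelian groups, both consequences of Pettis' lemma, finish the proof.

A bounded univalent function `ψ` exists, as in the first step of the Riemann mapping theorem. After
the change of variable `x = ψ`, the bracket is that of a derivation `D` with `D x = 1`. Bracket
identities then recover enough of the product: the graph of `f ↦ x * f` is cut out by bracket
equations, and twice the product of a constant and a function is a difference of brackets.

The decisive point is that the constants, the kernel of `D`, carry no topology wilder than that of
`ℂ`. The constants `a` for which `a - x` is not invertible form the image `ψ(Ω)`, which is bounded
with nonempty interior in `ℂ`. Invertibility is an injective projection of a closed set, so this set
is Borel in the unknown topology (Lusin–Souslin), and Pettis' lemma applied to its rescalings makes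
the map from constants to `ℂ` continuous. Finally, division by `x - ψ p` exhibits evaluation at `p`
as a component of a map with closed graph. -/

/-! ### Automatic continuity in Polish abelian groups. -/

section PolishGroups

open Filter Topology Pointwise MeasureTheory

/-- **Pettis' lemma**: if `s` has the Baire property and is not meagre, then `s - s` is a
neighbourhood of zero. -/
theorem BaireMeasurableSet.sub_self_mem_nhds_zero {G : Type*} [AddCommGroup G] [TopologicalSpace G]
    [IsTopologicalAddGroup G] [BaireSpace G] {s : Set G} (hs : BaireMeasurableSet s)
    (hm : ¬ IsMeagre s) : s - s ∈ 𝓝 (0 : G) := by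
  obtain ⟨U, hU, hsU⟩ := hs.residualEq_isOpen
  have hR : {b | b ∈ s ↔ b ∈ U} ∈ residual G := hsU.mem_iff
  have hne : U.Nonempty := by
    by_contra h
    rw [Set.not_nonempty_iff_eq_empty] at h
    refine hm (mem_of_superset hR fun b hb => ?_)
    simpa [h] using hb
  obtain ⟨a, ha⟩ := hne
  have hnhds : {x | a + x ∈ U} ∈ 𝓝 (0 : G) := by
    refine (continuous_const.add continuous_id).continuousAt.preimage_mem_nhds ?_
    simpa using hU.mem_nhds ha
  filter_upwards [hnhds] with x hx
  -- The translate of a comeagre set is comeagre, so some `b` in the nonempty open set `U ∩ (U - x)`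
  -- is generic for both conditions. Then `b` and `b + x` both lie in `s`.
  have hR' : {b | b + x ∈ s ↔ b + x ∈ U} ∈ residual G :=
    tendsto_residual_of_isOpenMap (Homeomorph.addRight x).continuous
      (Homeomorph.addRight x).isOpenMap hR
  obtain ⟨b, ⟨hbU, hbxU⟩, hb, hbx⟩ := (dense_of_mem_residual (inter_mem hR hR')).inter_open_nonempty
    (U ∩ (fun b => b + x) ⁻¹' U) (hU.inter (hU.preimage (continuous_id.add continuous_const)))
    ⟨a, ha, hx⟩
  exact Set.mem_sub.2 ⟨b + x, hbx.2 hbxU, b, hb.2 hbU, by abel⟩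

/-- Otherwise the whole group would be a countable union of meagre translates, against the Baire
property. -/
theorem not_isMeagre_of_countable_translates_cover {G : Type*} [AddCommGroup G] [TopologicalSpace G]
    [IsTopologicalAddGroup G] [BaireSpace G] {s : Set G} (c : ℕ → G)
    (hc : ∀ g, ∃ n, g - c n ∈ s) : ¬ IsMeagre s := by
  intro hs
  refine not_isMeagre_of_isOpen (X := G) isOpen_univ ⟨0, trivial⟩ ?_
  refine (isMeagre_iUnion (f := fun n => (fun g => g - c n) ⁻¹' s) fun n => ?_).mono
    fun g _ => Set.mem_iUnion.2 (hc g)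
  exact hs.preimage_of_isOpenMap (Homeomorph.subRight (c n)).continuous
    (Homeomorph.subRight (c n)).isOpenMap

/-- A homomorphism on a Baire group is continuous as soon as differences of elements of suitable
large sets with the Baire property are mapped to small elements. -/
theorem AddMonoidHom.continuous_of_baireMeasurableSet {G H : Type*} [AddCommGroup G]
    [TopologicalSpace G] [IsTopologicalAddGroup G] [BaireSpace G] [AddCommGroup H]
    [TopologicalSpace H] [IsTopologicalAddGroup H] (f : G →+ H)
    (h : ∀ U ∈ 𝓝 (0 : H), ∃ s : Set G, BaireMeasurableSet s ∧
      (∃ c : ℕ → G, ∀ g, ∃ n, g - c n ∈ s) ∧ ∀ a ∈ s, ∀ b ∈ s, f a - f b ∈ U) :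
    Continuous f := by
  refine continuous_of_continuousAt_zero f fun U hU => ?_
  rw [map_zero] at hU
  obtain ⟨s, hs, ⟨c, hc⟩, hsU⟩ := h U hU
  rw [mem_map]
  refine mem_of_superset (hs.sub_self_mem_nhds_zero
    (not_isMeagre_of_countable_translates_cover c hc)) ?_
  rintro _ ⟨a, ha, b, hb, rfl⟩
  simpa using hsU a ha b hb

/-- Preimages of small open sets are Borel, and separability of the range provides countably many
translates that cover. -/
theorem AddMonoidHom.continuous_of_measurable_of_baireSpace {G H : Type*} [AddCommGroup G]
    [TopologicalSpace G] [IsTopologicalAddGroup G] [BaireSpace G] [MeasurableSpace G] [BorelSpace G]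
    [AddCommGroup H] [TopologicalSpace H] [IsTopologicalAddGroup H] [SecondCountableTopology H]
    [MeasurableSpace H] [BorelSpace H] (f : G →+ H) (hf : Measurable f) : Continuous f := by
  refine f.continuous_of_baireMeasurableSet fun U hU => ?_
  obtain ⟨V, hV, hVo, hVU⟩ : ∃ V ∈ 𝓝 (0 : H), IsOpen V ∧ ∀ a ∈ V, ∀ b ∈ V, a - b ∈ U := by
    have : Tendsto (fun p : H × H => p.1 - p.2) (𝓝 0 ×ˢ 𝓝 0) (𝓝 0) := by
      rw [← nhds_prod_eq]
      exact (continuous_fst.sub continuous_snd).tendsto' _ _ (sub_zero 0)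
    obtain ⟨V, hV, hVU⟩ := mem_prod_same_iff.1 (this hU)
    obtain ⟨W, hWV, hWo, hW⟩ := mem_nhds_iff.1 hV
    exact ⟨W, hWo.mem_nhds hW, hWo, fun a ha b hb => hVU (Set.mk_mem_prod (hWV ha) (hWV hb))⟩
  have : Nonempty (Set.range f) := ⟨⟨0, 0, map_zero f⟩⟩
  obtain ⟨d, hd⟩ := exists_dense_seq (Set.range f)
  choose c hc using fun n => (d n).2
  refine ⟨f ⁻¹' V, (hf hVo.measurableSet).baireMeasurableSet, ⟨c, fun g => ?_⟩, fun a ha b hb =>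
    hVU _ ha _ hb⟩
  obtain ⟨_, hy, n, rfl⟩ := hd.inter_open_nonempty {y | f g - y.1 ∈ V}
    (hVo.preimage (continuous_const.sub continuous_subtype_val))
    ⟨⟨f g, g, rfl⟩, by simpa using mem_of_mem_nhds hV⟩
  exact ⟨n, by simpa [hc] using hy⟩

/-- **Open mapping theorem** for Polish abelian groups. -/
theorem AddEquiv.continuous_symm_of_polishSpace {G H : Type*} [AddCommGroup G] [TopologicalSpace G]
    [IsTopologicalAddGroup G] [PolishSpace G] [AddCommGroup H] [TopologicalSpace H]
    [IsTopologicalAddGroup H] [PolishSpace H] (e : G ≃+ H) (he : Continuous e) :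
    Continuous e.symm := by
  borelize G H
  have hm : Measurable e.symm := fun s hs => by
    rw [show e.symm ⁻¹' s = e '' s from (e.toEquiv.image_eq_preimage_symm s).symm]
    exact (he.measurableEmbedding e.injective).measurableSet_image.2 hs
  exact e.symm.toAddMonoidHom.continuous_of_measurable_of_baireSpace hm

/-- **Closed graph theorem** for Polish abelian groups. -/
theorem AddSubgroup.continuous_of_isClosed_of_forall_mem {G K : Type*} [AddCommGroup G]
    [TopologicalSpace G] [IsTopologicalAddGroup G] [PolishSpace G] [AddCommGroup K]
    [TopologicalSpace K] [IsTopologicalAddGroup K] [PolishSpace K] {P : AddSubgroup (G × K)}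
    (hP : IsClosed (P : Set (G × K))) (h0 : ∀ k, ((0 : G), k) ∈ P → k = 0) {f : G → K}
    (hf : ∀ g, (g, f g) ∈ P) : Continuous f := by
  have : PolishSpace P := hP.polishSpace
  -- The first projection of the closed graph is a continuous bijection of Polish groups, so its
  -- inverse is continuous.
  have hbij : Function.Bijective ((AddMonoidHom.fst G K).comp P.subtype) := by
    refine ⟨(injective_iff_map_eq_zero _).2 ?_, fun g => ⟨⟨_, hf g⟩, rfl⟩⟩
    rintro ⟨⟨g, k⟩, hp⟩ (rfl : g = 0)
    obtain rfl := h0 k hp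
    rfl
  set e : P ≃+ G := AddEquiv.ofBijective _ hbij with he
  have hc : Continuous e := continuous_fst.comp continuous_subtype_val
  have hfe : f = fun g => ((e.symm g : P) : G × K).2 := by
    ext1 g
    rw [show g = e ⟨_, hf g⟩ from rfl, e.symm_apply_apply]
    rfl
  rw [hfe]
  exact continuous_snd.comp (continuous_subtype_val.comp (e.continuous_symm_of_polishSpace hc))

end PolishGroups

/-! ### What continuity of the bracket of a derivation says about the product. -/

namespace Derivation

open Filter Topology


theorem eq_of_two_mul_eq {A : Type*} [CommRing A] [Algebra ℂ A] {a b : A} (h : 2 * a = 2 * b) :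
    a = b := by
  have h2 : IsUnit (algebraMap ℂ A 2) := (isUnit_iff_ne_zero.2 two_ne_zero).map _
  rw [map_ofNat] at h2
  exact h2.mul_left_cancel h

/-- The bracket with `1` is `D`. -/
theorem continuous_of_continuous_bracket {A : Type*} [CommRing A] [Algebra ℂ A]
    [TopologicalSpace A] (D : Derivation ℂ A A)
    (hb : Continuous fun p : A × A => p.1 * D p.2 - D p.1 * p.2) : Continuous D := by
  have := hb.comp (continuous_const (y := (1 : A)) |>.prodMk continuous_id)
  simpa [Function.comp_def] using this

theorem isClosed_ker_of_continuous {A : Type*} [CommRing A] [Algebra ℂ A] [TopologicalSpace A]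
    [T2Space A] (D : Derivation ℂ A A)
    (hD : Continuous D) :
    IsClosed (D.toLinearMap.toAddMonoidHom.ker : Set A) :=
  isClosed_eq hD continuous_const

variable {A : Type*} [CommRing A] [Algebra ℂ A] [TopologicalSpace A] [PolishSpace A]
  [IsTopologicalAddGroup A] (D : Derivation ℂ A A)

/-- If `D x = 1`, then the graph of multiplication by `x` is cut out by bracket equations. -/
theorem continuous_mul_left_of_continuous_bracket
    (hb : Continuous fun p : A × A => p.1 * D p.2 - D p.1 * p.2) {x : A} (hx : D x = 1) :
    Continuous fun f => x * f := by
  have hD := D.continuous_of_continuous_bracket hb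
  have hbr : ∀ a : A, Continuous fun f => a * D f - D a * f := fun a =>
    hb.comp (continuous_const.prodMk continuous_id)
  have hx2 : D (x ^ 2) = 2 * x := by simp [pow_two, hx]; ring
  -- For `h = x * f` one has `D h = [x, f] + 2f` and `[x, h] - [x², f] = 2h`. When `f = 0`, the
  -- first equation gives `D h = 0` and the second becomes `-h = 2h`, so `h = 0`.
  let P : AddSubgroup (A × A) :=
    { carrier := {p | D p.2 = (x * D p.1 - D x * p.1) + (p.1 + p.1) ∧
        (x * D p.2 - D x * p.2) - (x ^ 2 * D p.1 - D (x ^ 2) * p.1) = p.2 + p.2}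
      add_mem' := by
        rintro ⟨a, b⟩ ⟨c, d⟩ ⟨h1, h2⟩ ⟨h3, h4⟩
        simp only [Prod.mk_add_mk, Set.mem_ofPred_eq, map_add] at *
        exact ⟨by linear_combination h1 + h3, by linear_combination h2 + h4⟩
      zero_mem' := by simp
      neg_mem' := by
        rintro ⟨a, b⟩ ⟨h1, h2⟩
        simp only [Prod.neg_mk, Set.mem_ofPred_eq, map_neg] at *
        exact ⟨by linear_combination -h1, by linear_combination -h2⟩ }
  have hP : IsClosed (P : Set (A × A)) := by
    refine (isClosed_eq (hD.comp continuous_snd) ?_).inter (isClosed_eq ?_ ?_)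
    · exact ((hbr x).comp continuous_fst).add (continuous_fst.add continuous_fst)
    · exact ((hbr x).comp continuous_snd).sub ((hbr (x ^ 2)).comp continuous_fst)
    · exact continuous_snd.add continuous_snd
  refine AddSubgroup.continuous_of_isClosed_of_forall_mem hP ?_ (f := fun f => x * f) ?_
  · rintro k ⟨h1, h2⟩
    simp only [map_zero, mul_zero, sub_zero, add_zero, hx, one_mul] at h1 h2
    rw [h1, mul_zero, zero_sub] at h2
    have h3 : (3 : A) * k = 0 := by linear_combination -h2
    have hu : IsUnit (algebraMap ℂ A 3) := (isUnit_iff_ne_zero.2 three_ne_zero).map _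
    rw [map_ofNat] at hu
    exact hu.mul_right_eq_zero.1 h3
  · intro g
    refine ⟨?_, ?_⟩ <;> simp only [leibniz, smul_eq_mul, hx, hx2] <;> ring

/-- Multiplication by constants is continuous in both variables, up to a factor `2`. -/
theorem continuous_two_mul_mul_of_continuous_bracket
    (hb : Continuous fun p : A × A => p.1 * D p.2 - D p.1 * p.2) {x : A} (hx : D x = 1) :
    Continuous fun p : D.toLinearMap.toAddMonoidHom.ker × A => 2 * ((p.1 : A) * p.2) := by
  have hm := D.continuous_mul_left_of_continuous_bracket hb hx
  have h1 : Continuous fun p : D.toLinearMap.toAddMonoidHom.ker × A => (p.1 : A) :=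
    continuous_subtype_val.comp continuous_fst
  have h2 : Continuous fun p : D.toLinearMap.toAddMonoidHom.ker × A => p.2 := continuous_snd
  -- For constant `a`, `[a, x g] - [x a, g] = 2 a g`.
  refine ((hb.comp (h1.prodMk (hm.comp h2))).sub (hb.comp ((hm.comp h1).prodMk h2))).congr ?_
  rintro ⟨⟨a, ha⟩, g⟩
  replace ha : D a = 0 := ha
  change ((a * D (x * g) - D a * (x * g)) - (x * a * D g - D (x * a) * g)) = _
  simp only [leibniz, smul_eq_mul, hx, ha]
  ring

/-- The scalars, as the kernel of a derivation that kills nothing else. -/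
noncomputable def kerEquiv {A : Type*} [CommRing A] [Algebra ℂ A] [Nontrivial A]
    (D : Derivation ℂ A A) (hker : ∀ f, D f = 0 → ∃ c : ℂ, algebraMap ℂ A c = f) :
    ℂ ≃+ D.toLinearMap.toAddMonoidHom.ker :=
  AddEquiv.ofBijective
    ((algebraMap ℂ A).toAddMonoidHom.codRestrict _ fun c => D.map_algebraMap c)
    ⟨fun a b h => (algebraMap ℂ A).injective (congrArg Subtype.val h), fun f => by
      obtain ⟨c, hc⟩ := hker f f.2
      exact ⟨c, Subtype.ext hc⟩⟩

theorem coe_kerEquiv {A : Type*} [CommRing A] [Algebra ℂ A] [Nontrivial A]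
    (D : Derivation ℂ A A) (hker : ∀ f, D f = 0 → ∃ c : ℂ, algebraMap ℂ A c = f) (c : ℂ) :
    (D.kerEquiv hker c : A) = algebraMap ℂ A c := rfl

theorem algebraMap_kerEquiv_symm {A : Type*} [CommRing A] [Algebra ℂ A] [Nontrivial A]
    (D : Derivation ℂ A A) (hker : ∀ f, D f = 0 → ∃ c : ℂ, algebraMap ℂ A c = f)
    (a : D.toLinearMap.toAddMonoidHom.ker) :
    algebraMap ℂ A ((D.kerEquiv hker).symm a) = a := by
  rw [← D.coe_kerEquiv hker, AddEquiv.apply_symm_apply]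

/-- The constants at which `x` takes no value form a Borel set. -/
theorem measurableSet_isUnit_sub
    (hb : Continuous fun p : A × A => p.1 * D p.2 - D p.1 * p.2) {x : A} (hx : D x = 1)
    [MeasurableSpace D.toLinearMap.toAddMonoidHom.ker]
    [BorelSpace D.toLinearMap.toAddMonoidHom.ker] :
    MeasurableSet {a : D.toLinearMap.toAddMonoidHom.ker | IsUnit ((a : A) - x)} := by
  have hm := D.continuous_mul_left_of_continuous_bracket hb hx
  have h2 := D.continuous_two_mul_mul_of_continuous_bracket hb hx
  have : PolishSpace D.toLinearMap.toAddMonoidHom.ker :=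
    (D.isClosed_ker_of_continuous (D.continuous_of_continuous_bracket hb)).polishSpace
  set E : Set (D.toLinearMap.toAddMonoidHom.ker × A) := {p | ((p.1 : A) - x) * p.2 = 1} with hE
  have hEc : IsClosed E := by
    -- The product with a constant is known to be continuous only after doubling, so the equation is
    -- doubled; nothing is lost, as `2` is invertible.
    have : E = {p | 2 * ((p.1 : A) * p.2) = 2 + (x * p.2 + x * p.2)} := by
      ext p
      refine ⟨fun h => ?_, fun h => ?_⟩
      · replace h : ((p.1 : A) - x) * p.2 = 1 := h
        change 2 * ((p.1 : A) * p.2) = 2 + (x * p.2 + x * p.2)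
        linear_combination 2 * h
      · replace h : 2 * ((p.1 : A) * p.2) = 2 + (x * p.2 + x * p.2) := h
        refine eq_of_two_mul_eq (?_ : 2 * (((p.1 : A) - x) * p.2) = 2 * 1)
        linear_combination h
    rw [this]
    exact isClosed_eq h2 (continuous_const.add
      ((hm.comp continuous_snd).add (hm.comp continuous_snd)))
  have hEi : {a : D.toLinearMap.toAddMonoidHom.ker | IsUnit ((a : A) - x)} = Prod.fst '' E := by
    ext a
    simp only [Set.mem_ofPred_eq, isUnit_iff_exists_inv, hE, Set.mem_image, Prod.exists,
      exists_and_right, exists_eq_right]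
  rw [hEi]
  borelize A
  -- Inverses are unique, so the projection is injective on `E` and Lusin–Souslin applies.
  refine hEc.measurableSet_image_of_continuousOn_injOn continuous_fst.continuousOn ?_
  rintro ⟨a, f⟩ hf ⟨_, g⟩ hg rfl
  refine Prod.ext rfl ?_
  simp only [hE, Set.mem_ofPred_eq] at hf hg ⊢
  calc f = f * ((a - x) * g) := by rw [hg, mul_one]
    _ = ((a - x) * f) * g := by ring
    _ = g := by rw [hf, one_mul]

/-- The spectrum of `x`, viewed among the constants, is Borel. Boundedness makes its rescalings
small; interior points let countably many translates of each rescaling cover. -/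
theorem continuous_kerEquiv_symm [Nontrivial A]
    (hb : Continuous fun p : A × A => p.1 * D p.2 - D p.1 * p.2) {x : A} (hx : D x = 1)
    (hker : ∀ f, D f = 0 → ∃ c : ℂ, algebraMap ℂ A c = f)
    (hbdd : Bornology.IsBounded (spectrum ℂ x)) (hint : (interior (spectrum ℂ x)).Nonempty) :
    Continuous (D.kerEquiv hker).symm := by
  have : PolishSpace D.toLinearMap.toAddMonoidHom.ker :=
    (D.isClosed_ker_of_continuous (D.continuous_of_continuous_bracket hb)).polishSpace
  borelize (D.toLinearMap.toAddMonoidHom.ker : Type _)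
  have hE := D.measurableSet_isUnit_sub hb hx
  refine (D.kerEquiv hker).symm.toAddMonoidHom.continuous_of_baireMeasurableSet fun U hU => ?_
  obtain ⟨ε, hε, hεU⟩ := Metric.mem_nhds_iff.1 hU
  obtain ⟨R, hR⟩ := hbdd.subset_closedBall 0
  obtain ⟨n, hn⟩ := exists_nat_gt (2 * R / ε)
  obtain ⟨p, hp⟩ := hint
  have hR0 : 0 ≤ R := (norm_nonneg p).trans (by simpa using hR (interior_subset hp))
  have hn0 : (0 : ℝ) < n := lt_of_le_of_lt (by positivity) hn
  have hn0' : (n : ℂ) ≠ 0 := by exact_mod_cast hn0.ne'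
  have hspec : ∀ a, n • a ∈ {a : D.toLinearMap.toAddMonoidHom.ker | IsUnit ((a : A) - x)}ᶜ ↔
      (n : ℂ) * (D.kerEquiv hker).symm a ∈ spectrum ℂ x := by
    intro a
    rw [spectrum.mem_iff, ← nsmul_eq_mul, ← map_nsmul, algebraMap_kerEquiv_symm]
    rfl
  -- The set is `n⁻¹` times the spectrum, of diameter at most `2R / n < ε`. Scaling by a natural
  -- number is continuous in any topological group, so it stays Borel.
  refine ⟨(fun a => n • a) ⁻¹' {a | IsUnit ((a : A) - x)}ᶜ,
    ((continuous_nsmul n).measurable hE.compl).baireMeasurableSet,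
    ⟨fun k => D.kerEquiv hker (denseSeq ℂ k), fun g => ?_⟩, fun a ha b hb' => hεU ?_⟩
  · obtain ⟨_, hy, k, rfl⟩ := (denseRange_denseSeq ℂ).inter_open_nonempty
      {z | (n : ℂ) * ((D.kerEquiv hker).symm g - z) ∈ interior (spectrum ℂ x)}
      (isOpen_interior.preimage (by fun_prop))
      ⟨(D.kerEquiv hker).symm g - p / n, by
        simpa [mul_div_cancel₀ _ hn0'] using hp⟩
    refine ⟨k, (hspec _).2 ?_⟩
    rw [map_sub, AddEquiv.symm_apply_apply]
    exact interior_subset hy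
  · have h1 := hR ((hspec a).1 ha)
    have h2 := hR ((hspec b).1 hb')
    rw [mem_closedBall_zero_iff, norm_mul, Complex.norm_natCast] at h1 h2
    rw [mem_ball_zero_iff]
    rw [div_lt_iff₀ hε] at hn
    have h3 := norm_sub_le ((D.kerEquiv hker).symm a) ((D.kerEquiv hker).symm b)
    refine h3.trans_lt ?_
    rw [← mul_lt_mul_iff_right₀ hn0]
    linarith

/-- Characters whose kernel is generated by `x - χ x` are continuous. -/
theorem continuous_algHom_of_continuous_bracket [Nontrivial A]
    (hb : Continuous fun p : A × A => p.1 * D p.2 - D p.1 * p.2) {x : A} (hx : D x = 1)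
    (hker : ∀ f, D f = 0 → ∃ c : ℂ, algebraMap ℂ A c = f)
    (hbdd : Bornology.IsBounded (spectrum ℂ x)) (hint : (interior (spectrum ℂ x)).Nonempty)
    (χ : A →ₐ[ℂ] ℂ) (hχ : ∀ f, χ f = 0 → ∃ g, f = (x - algebraMap ℂ A (χ x)) * g)
    (hreg : ∀ g, (x - algebraMap ℂ A (χ x)) * g = 0 → g = 0) : Continuous χ := by
  have hm := D.continuous_mul_left_of_continuous_bracket hb hx
  have h2 := D.continuous_two_mul_mul_of_continuous_bracket hb hx
  have : PolishSpace D.toLinearMap.toAddMonoidHom.ker :=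
    (D.isClosed_ker_of_continuous (D.continuous_of_continuous_bracket hb)).polishSpace
  have hκ := D.continuous_kerEquiv_symm hb hx hker hbdd hint
  set a : A := algebraMap ℂ A (χ x) with ha
  -- The graph of `f ↦ (χ f, (f - χ f) / (x - χ x))`, with `χ f` regarded as a constant in `A`.
  let P : AddSubgroup (A × (D.toLinearMap.toAddMonoidHom.ker × A)) :=
    { carrier := {p | p.1 - p.2.1 = (x - a) * p.2.2}
      add_mem' := by
        rintro ⟨f, c, g⟩ ⟨f', c', g'⟩ h h'
        simp only [Prod.mk_add_mk, Set.mem_ofPred_eq, AddSubgroup.coe_add] at *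
        linear_combination h + h'
      zero_mem' := by simp
      neg_mem' := by
        rintro ⟨f, c, g⟩ h
        simp only [Prod.neg_mk, Set.mem_ofPred_eq, AddSubgroup.coe_neg] at *
        linear_combination -h }
  have hP : IsClosed (P : Set (A × (D.toLinearMap.toAddMonoidHom.ker × A))) := by
    have : (P : Set (A × (D.toLinearMap.toAddMonoidHom.ker × A))) =
        {p | (p.1 - p.2.1) + (p.1 - p.2.1) = (x * p.2.2 + x * p.2.2) -
          2 * ((D.kerEquiv hker (χ x) : A) * p.2.2)} := by
      ext p
      simp only [coe_kerEquiv]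
      refine ⟨fun h => ?_, fun h => ?_⟩
      · replace h : p.1 - p.2.1 = (x - a) * p.2.2 := h
        change (p.1 - p.2.1) + (p.1 - p.2.1) = (x * p.2.2 + x * p.2.2) - 2 * (a * p.2.2)
        linear_combination 2 * h
      · replace h : (p.1 - p.2.1) + (p.1 - p.2.1) = (x * p.2.2 + x * p.2.2) -
          2 * (a * p.2.2) := h
        refine eq_of_two_mul_eq (?_ : 2 * (p.1 - p.2.1) = 2 * ((x - a) * p.2.2))
        linear_combination h
    rw [this]
    have hc : Continuous fun p : A × (D.toLinearMap.toAddMonoidHom.ker × A) =>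
        p.1 - (p.2.1 : A) :=
      continuous_fst.sub (continuous_subtype_val.comp (continuous_fst.comp continuous_snd))
    have hg := (continuous_snd (X := D.toLinearMap.toAddMonoidHom.ker) (Y := A)).comp
      (continuous_snd (X := A))
    exact isClosed_eq (hc.add hc) (((hm.comp hg).add (hm.comp hg)).sub
      (h2.comp (continuous_const.prodMk hg)))
  have hex : ∀ f, ∃ g, f - algebraMap ℂ A (χ f) = (x - a) * g := fun f => hχ _ (by simp)
  choose q hq using hex
  have hcont := AddSubgroup.continuous_of_isClosed_of_forall_mem hP
    (f := fun f => (D.kerEquiv hker (χ f), q f)) (by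
      -- Applying `χ` kills the right-hand side, so `c = 0`; regularity of `x - χ x` then gives `g =
      -- 0`.
      rintro ⟨c, g⟩ h
      obtain ⟨c, rfl⟩ := (D.kerEquiv hker).surjective c
      replace h : 0 - algebraMap ℂ A c = (x - a) * g := h
      have hc : c = 0 := by simpa [ha] using congrArg χ h
      subst hc
      rw [map_zero, sub_zero] at h
      rw [hreg g h.symm, map_zero]
      rfl) hq
  simpa [Function.comp_def] using hκ.comp (continuous_fst.comp hcont)

end Derivation

/-! ### Transport of the topology and change of variable. -/

/-- Transport of `Derivation.continuous_algHom_of_continuous_bracket` along an additive bijection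
from a Polish group. -/
theorem AddEquiv.continuous_algHom_of_continuous_bracket {S A : Type*} [AddCommGroup S]
    [TopologicalSpace S] [PolishSpace S] [IsTopologicalAddGroup S] [CommRing A] [Algebra ℂ A]
    [Nontrivial A] (Φ : S ≃+ A) (d : A → A) (hadd : ∀ f g, d (f + g) = d f + d g)
    (hsmul : ∀ (c : ℂ) f, d (c • f) = c • d f) (hmul : ∀ f g, d (f * g) = f * d g + g * d f)
    (hb : Continuous fun p : S × S => Φ.symm (Φ p.1 * d (Φ p.2) - d (Φ p.1) * Φ p.2))
    {x : A} (hx : d x = 1) (hker : ∀ f, d f = 0 → ∃ c : ℂ, algebraMap ℂ A c = f)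
    (hbdd : Bornology.IsBounded (spectrum ℂ x)) (hint : (interior (spectrum ℂ x)).Nonempty)
    (χ : A →ₐ[ℂ] ℂ) (hχ : ∀ f, χ f = 0 → ∃ g, f = (x - algebraMap ℂ A (χ x)) * g)
    (hreg : ∀ g, (x - algebraMap ℂ A (χ x)) * g = 0 → g = 0) :
    Continuous fun s => χ (Φ s) := by
  let D : Derivation ℂ A A := .mk' { toFun := d, map_add' := hadd, map_smul' := hsmul } hmul
  let : TopologicalSpace A := .induced Φ.symm inferInstance
  have hsymm : Continuous Φ.symm := continuous_induced_dom
  have hΦ : Continuous Φ :=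
    continuous_induced_rng.2 (continuous_id.congr fun s => (Φ.symm_apply_apply s).symm)
  have : PolishSpace A := Φ.symm.toEquiv.polishSpace_induced
  have : IsTopologicalAddGroup A := topologicalAddGroup_induced Φ.symm
  have hD : Continuous fun p : A × A => p.1 * D p.2 - D p.1 * p.2 := by
    have := hΦ.comp (hb.comp ((hsymm.comp continuous_fst).prodMk (hsymm.comp continuous_snd)))
    refine this.congr fun p => ?_
    simp only [Function.comp_apply, AddEquiv.apply_symm_apply]
    rfl
  exact (D.continuous_algHom_of_continuous_bracket hD (x := x) hx hker hbdd hint χ hχ hreg).comp hΦ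

/-- Change of the derivation by a unit in `AddEquiv.continuous_algHom_of_continuous_bracket`. -/
theorem AddEquiv.continuous_algHom_of_isUnit {S A : Type*} [AddCommGroup S]
    [TopologicalSpace S] [PolishSpace S] [IsTopologicalAddGroup S] [CommRing A] [Algebra ℂ A]
    [Nontrivial A] (φ : S ≃+ A) (d : A → A) (hadd : ∀ f g, d (f + g) = d f + d g)
    (hsmul : ∀ (c : ℂ) f, d (c • f) = c • d f) (hmul : ∀ f g, d (f * g) = d f * g + f * d g)
    (hb : Continuous fun p : S × S => φ.symm (φ p.1 * d (φ p.2) - d (φ p.1) * φ p.2))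
    {x : A} (hx : IsUnit (d x)) (hker : ∀ f, d f = 0 → ∃ c : ℂ, algebraMap ℂ A c = f)
    (hbdd : Bornology.IsBounded (spectrum ℂ x)) (hint : (interior (spectrum ℂ x)).Nonempty)
    (χ : A →ₐ[ℂ] ℂ) (hχ : ∀ f, χ f = 0 → ∃ g, f = (x - algebraMap ℂ A (χ x)) * g)
    (hreg : ∀ g, (x - algebraMap ℂ A (χ x)) * g = 0 → g = 0) :
    Continuous fun s => χ (φ s) := by
  obtain ⟨e, he⟩ := isUnit_iff_exists_inv.1 hx
  -- Change of variable for vector fields: the bracket of `e * d` at `φ s * d x` and `φ t * d x` is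
  -- `d x` times the bracket of `d` at `φ s` and `φ t`. Hence the transported bracket on `S` is
  -- unchanged, while `x` now has derivative `1`.
  let Φ : S ≃+ A :=
    { toFun := fun s => φ s * d x
      invFun := fun f => φ.symm (f * e)
      left_inv := fun s => by
        change φ.symm (φ s * d x * e) = s
        rw [mul_assoc, he, mul_one, φ.symm_apply_apply]
      right_inv := fun f => by
        change φ (φ.symm (f * e)) * d x = f
        rw [φ.apply_symm_apply, mul_assoc, mul_comm e, he, mul_one]
      map_add' := fun s t => by rw [map_add, add_mul] }
  have key := Φ.continuous_algHom_of_continuous_bracket (fun f => e * d f)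
    (fun f g => by rw [hadd, mul_add]) (fun c f => by rw [hsmul, mul_smul_comm])
    (fun f g => by rw [hmul]; ring)
    (hb.congr fun q => by
      refine congrArg φ.symm ?_
      change _ = (φ q.1 * d x * (e * d (φ q.2 * d x)) - e * d (φ q.1 * d x) * (φ q.2 * d x)) * e
      rw [hmul, hmul]
      linear_combination (-(φ q.1 * d (φ q.2) - d (φ q.1) * φ q.2) * (1 + d x * e)) * he)
    (x := x) (by rw [mul_comm, he])
    (fun f hf => hker f (by
      calc d f = d x * (e * d f) := by rw [← mul_assoc, he, one_mul]
        _ = 0 := by rw [hf, mul_zero])) hbdd hint χ hχ hreg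
  -- Multiplication by the number `χ e` removes the factor `d x` put in by `Φ`.
  refine (key.mul (continuous_const (y := χ e))).congr fun s => ?_
  change χ (φ s * d x) * χ e = χ (φ s)
  rw [← map_mul, mul_assoc, he, mul_one]

/-! ### The compact-open topology on analytic functions. -/

namespace AnalyticFunctions

open Filter Topology

variable {Ω : Opens ℂ}

theorem differentiableOn_extendZero (f : analyticSubalgebra Ω) :
    DifferentiableOn ℂ (extendZero Ω f.1) Ω :=
  AnalyticOnNhd.differentiableOn f.2

/-- The element of `analyticSubalgebra Ω` given by a function that is holomorphic on `Ω`. -/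
noncomputable def ofDifferentiableOn (F : ℂ → ℂ) (hF : DifferentiableOn ℂ F Ω) :
    analyticSubalgebra Ω :=
  ⟨⟨fun z => F z, continuousOn_iff_continuous_domRestrict.1 hF.continuousOn⟩, fun z hz =>
    (hF.analyticOnNhd Ω.isOpen z hz).congr (extendZero_eventuallyEq (fun _ => rfl) ⟨z, hz⟩).symm⟩

theorem ofDifferentiableOn_apply (F : ℂ → ℂ) (hF : DifferentiableOn ℂ F Ω) (z : Ω) :
    (ofDifferentiableOn F hF).1 z = F z := rfl

theorem derivative_ofDifferentiableOn_apply (F : ℂ → ℂ) (hF : DifferentiableOn ℂ F Ω) (z : Ω) :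
    (derivative (ofDifferentiableOn F hF)).1 z = deriv F z :=
  (extendZero_eventuallyEq (F := F) (fun _ => rfl) z).deriv_eq

theorem derivative_smul (c : ℂ) (f : analyticSubalgebra Ω) :
    derivative (c • f) = c • derivative f := by
  ext z
  change deriv (extendZero Ω (c • f.1)) z = c * deriv (extendZero Ω f.1) z
  rw [(extendZero_eventuallyEq (F := fun w => c * extendZero Ω f.1 w)
    (fun w => by simp [extendZero_apply]) z).deriv_eq]
  exact deriv_const_mul c (f.2 z z.2).differentiableAt

theorem tendstoLocallyUniformlyOn_extendZero {l : Filter C(Ω, ℂ)} {f : C(Ω, ℂ)}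
    (h : Tendsto id l (𝓝 f)) :
    TendstoLocallyUniformlyOn (fun g : C(Ω, ℂ) => extendZero Ω g) (extendZero Ω f) l Ω := by
  have : LocallyCompactSpace Ω := Ω.isOpen.locallyCompactSpace
  rw [ContinuousMap.tendsto_iff_tendstoLocallyUniformly] at h
  rw [tendstoLocallyUniformlyOn_iff_tendstoLocallyUniformly_comp_coe]
  intro u hu x
  obtain ⟨t, ht, hu⟩ := h u hu x
  refine ⟨t, ht, hu.mono fun g hg y hy => ?_⟩
  simpa only [Function.comp_apply, extendZero_apply, id] using hg y hy

/-- Weierstrass: locally uniform limits of holomorphic functions are holomorphic. -/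
theorem isClosed_analyticSubalgebra : IsClosed (analyticSubalgebra Ω : Set C(Ω, ℂ)) := by
  refine isClosed_iff_clusterPt.2 fun f hf => ?_
  have : (𝓝 f ⊓ 𝓟 (analyticSubalgebra Ω : Set C(Ω, ℂ))).NeBot := hf
  refine DifferentiableOn.analyticOnNhd ?_ Ω.isOpen
  exact (tendstoLocallyUniformlyOn_extendZero (l := 𝓝 f ⊓ 𝓟 (analyticSubalgebra Ω : Set C(Ω, ℂ)))
    inf_le_left).differentiableOn
    (Eventually.filter_mono inf_le_right (fun g hg => AnalyticOnNhd.differentiableOn hg))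
    Ω.isOpen

theorem polishSpace_analyticSubalgebra : PolishSpace (analyticSubalgebra Ω) := by
  have : LocallyCompactSpace Ω := Ω.isOpen.locallyCompactSpace
  have : PolishSpace C(Ω, ℂ) := { }
  exact isClosed_analyticSubalgebra.polishSpace

/-- Weierstrass: locally uniform convergence of holomorphic functions passes to derivatives. -/
theorem continuous_derivative :
    Continuous (derivative : analyticSubalgebra Ω → analyticSubalgebra Ω) := by
  have : LocallyCompactSpace Ω := Ω.isOpen.locallyCompactSpace
  refine continuous_induced_rng.2 (continuous_iff_continuousAt.2 fun f => ?_)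
  refine ContinuousMap.tendsto_iff_tendstoLocallyUniformly.2 ?_
  have h : TendstoLocallyUniformlyOn (fun g : analyticSubalgebra Ω => extendZero Ω g.1)
      (extendZero Ω f.1) (𝓝 f) Ω := by
    have := tendstoLocallyUniformlyOn_extendZero (l := map Subtype.val (𝓝 f)) (f := f.1)
      continuous_subtype_val.continuousAt
    intro u hu x hx
    obtain ⟨t, ht, h⟩ := this u hu x hx
    exact ⟨t, ht, h⟩
  have h' := h.deriv (.of_forall differentiableOn_extendZero) Ω.isOpen
  rw [tendstoLocallyUniformlyOn_iff_tendstoLocallyUniformly_comp_coe] at h'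
  exact h'

theorem isTopologicalRing_analyticSubalgebra : IsTopologicalRing (analyticSubalgebra Ω) :=
  have : LocallyCompactSpace Ω := Ω.isOpen.locallyCompactSpace
  inferInstanceAs (IsTopologicalRing (analyticSubalgebra Ω).toSubring)

theorem continuous_apply (z : Ω) : Continuous fun f : analyticSubalgebra Ω => f.1 z :=
  (continuous_eval_const z).comp continuous_subtype_val

end AnalyticFunctions

open AnalyticFunctions in
instance AnalyticLieRing.isTopologicalAddGroup (Ω : Opens ℂ) :
    IsTopologicalAddGroup (AnalyticLieRing Ω) :=
  @IsTopologicalRing.to_topologicalAddGroup (analyticSubalgebra Ω) _ _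
    isTopologicalRing_analyticSubalgebra

open AnalyticFunctions in
instance AnalyticLieRing.polishSpace (Ω : Opens ℂ) : PolishSpace (AnalyticLieRing Ω) :=
  polishSpace_analyticSubalgebra (Ω := Ω)

open AnalyticFunctions in
instance AnalyticLieRing.isPolishLieRing (Ω : Opens ℂ) : IsPolishLieRing (AnalyticLieRing Ω) where
  continuous_bracket := by
    have : LocallyCompactSpace Ω := Ω.isOpen.locallyCompactSpace
    have hv : Continuous (Subtype.val : analyticSubalgebra Ω → C(Ω, ℂ)) := continuous_subtype_val
    have hd := hv.comp (continuous_derivative (Ω := Ω))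
    exact continuous_induced_rng.2 (((hv.comp continuous_fst).mul (hd.comp continuous_snd)).sub
      ((hd.comp continuous_fst).mul (hv.comp continuous_snd)))

/-! ### A bounded univalent function. -/

/-- A simply connected proper open subset of `ℂ` carries a bounded univalent function. -/
theorem exists_isBounded_image_injOn_deriv_ne_zero {U : Set ℂ} (hUo : IsOpen U)
    (hUc : IsSimplyConnected U) (hU : U ≠ Set.univ) :
    ∃ ψ : ℂ → ℂ, Bornology.IsBounded (ψ '' U) ∧ Set.InjOn ψ U ∧ ∀ z ∈ U, deriv ψ z ≠ 0 := by
  obtain ⟨a, ha⟩ := (Set.ne_univ_iff_exists_notMem U).1 hU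
  obtain ⟨f, hfc, hf⟩ := Complex.exists_continuousOn_pow_eq hUc hUo
    (g := fun z => z - a) (by fun_prop) (by
      rintro ⟨z, hz, hza⟩
      exact ha (sub_eq_zero.1 hza ▸ hz)) two_ne_zero
  have hf0 : ∀ z ∈ U, f z ≠ 0 := by
    intro z hz h0
    have := hf z
    rw [h0, zero_pow two_ne_zero] at this
    exact ha (sub_eq_zero.1 this.symm ▸ hz)
  have hfinj : ∀ z w, f z ^ 2 = f w ^ 2 → z = w := fun z w h => by
    simpa [hf] using h
  have hdf : ∀ z ∈ U, HasStrictDerivAt f (2 * f z)⁻¹ z := fun z hz => by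
    have h : HasStrictDerivAt (fun w : ℂ => w ^ 2 + a) (2 * f z) (f z) := by
      simpa using (hasStrictDerivAt_pow 2 (f z)).add_const a
    exact h.of_local_left_inverse (hfc.continuousAt (hUo.mem_nhds hz))
      (mul_ne_zero two_ne_zero (hf0 z hz)) (.of_forall fun w => by simp [hf])
  obtain ⟨b, hb⟩ := hUc.nonempty
  obtain ⟨ε, hε, hεU⟩ : ∃ ε > 0, Metric.ball (f b) ε ⊆ f '' U := by
    refine Metric.mem_nhds_iff.1 ?_
    rw [← (hdf b hb).map_nhds_eq (inv_ne_zero (mul_ne_zero two_ne_zero (hf0 b hb)))]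
    exact Filter.image_mem_map (hUo.mem_nhds hb)
  -- As `f` is an injective nonvanishing square root of `z - a`, the sets `f(U)` and `-f(U)` are
  -- disjoint. Since `f(U)` contains a ball about `f b`, it misses the opposite ball about `-f b`.
  have hfar : ∀ z ∈ U, ε ≤ ‖f z + f b‖ := by
    intro z hz
    by_contra! h
    obtain ⟨w, hw, hwz⟩ := hεU (show -f z ∈ Metric.ball (f b) ε by
      rwa [mem_ball_iff_norm, ← neg_add', norm_neg])
    obtain rfl := hfinj w z (by rw [hwz, neg_sq])
    exact hf0 w hz (self_eq_neg.1 hwz)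
  have hne : ∀ z ∈ U, f z + f b ≠ 0 := fun z hz => norm_pos_iff.1 (hε.trans_le (hfar z hz))
  refine ⟨fun z => (f z + f b)⁻¹, ?_, fun z _ w _ h => hfinj z w ?_, fun z hz => ?_⟩
  · refine isBounded_iff_forall_norm_le.2 ⟨ε⁻¹, ?_⟩
    rintro _ ⟨z, hz, rfl⟩
    rw [norm_inv]
    exact inv_anti₀ hε (hfar z hz)
  · rw [add_right_cancel (inv_injective h)]
  · rw [(((hdf z hz).hasDerivAt.add_const (f b)).fun_inv (hne z hz)).deriv]
    exact div_ne_zero (neg_ne_zero.2 (inv_ne_zero (mul_ne_zero two_ne_zero (hf0 z hz))))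
      (pow_ne_zero 2 (hne z hz))

/-! ### Units, spectra and point evaluations in the algebra of analytic functions. -/

namespace AnalyticFunctions

open Filter Topology

variable {Ω : Opens ℂ}

theorem mul_apply (f g : analyticSubalgebra Ω) (z : Ω) : (f * g).1 z = f.1 z * g.1 z := rfl

theorem one_apply (z : Ω) : (1 : analyticSubalgebra Ω).1 z = 1 := rfl

theorem ext_apply {f g : analyticSubalgebra Ω} (h : ∀ z, f.1 z = g.1 z) : f = g :=
  Subtype.ext (ContinuousMap.ext h)

theorem sub_algebraMap_apply (f : analyticSubalgebra Ω) (c : ℂ) (z : Ω) :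
    (f - algebraMap ℂ (analyticSubalgebra Ω) c).1 z = f.1 z - c := rfl

theorem algebraMap_sub_apply (f : analyticSubalgebra Ω) (c : ℂ) (z : Ω) :
    (algebraMap ℂ (analyticSubalgebra Ω) c - f).1 z = c - f.1 z := rfl

/-- Evaluation at a point of `Ω`. -/
noncomputable def evalAlgHom (p : Ω) : analyticSubalgebra Ω →ₐ[ℂ] ℂ where
  toFun f := f.1 p
  map_one' := rfl
  map_mul' _ _ := rfl
  map_zero' := rfl
  map_add' _ _ := rfl
  commutes' _ := rfl

theorem isUnit_of_forall_ne_zero {f : analyticSubalgebra Ω} (h : ∀ z, f.1 z ≠ 0) : IsUnit f := by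
  have hd : DifferentiableOn ℂ (fun z => (extendZero Ω f.1 z)⁻¹) Ω :=
    (differentiableOn_extendZero f).inv fun z hz => by
      rw [show z = (⟨z, hz⟩ : Ω) from rfl, extendZero_apply]
      exact h _
  refine isUnit_iff_exists_inv.2 ⟨ofDifferentiableOn _ hd, ext_apply fun z => ?_⟩
  rw [mul_apply, ofDifferentiableOn_apply, extendZero_apply, mul_inv_cancel₀ (h z), one_apply]

theorem spectrum_eq_range (f : analyticSubalgebra Ω) : spectrum ℂ f = Set.range f.1 := by
  ext c
  rw [spectrum.mem_iff]
  constructor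
  · intro hc
    by_contra hr
    exact hc (isUnit_of_forall_ne_zero fun z hz => hr ⟨z, by
      rw [algebraMap_sub_apply, sub_eq_zero] at hz
      exact hz.symm⟩)
  · rintro ⟨z, rfl⟩ hu
    refine (hu.map (evalAlgHom z)).ne_zero ?_
    exact sub_self (f.1 z)

theorem exists_algebraMap_eq_of_derivative_eq_zero (hΩ : IsPreconnected (Ω : Set ℂ))
    {f : analyticSubalgebra Ω} (hf : derivative f = 0) :
    ∃ c : ℂ, algebraMap ℂ (analyticSubalgebra Ω) c = f := by
  obtain ⟨c, hc⟩ := Ω.isOpen.exists_is_const_of_deriv_eq_zero hΩ (differentiableOn_extendZero f)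
    fun z hz => congrArg (fun g : analyticSubalgebra Ω => g.1 ⟨z, hz⟩) hf
  exact ⟨c, ext_apply fun z => ((extendZero_apply f.1 z).symm.trans (hc z z.2)).symm⟩

theorem differentiableOn_of_deriv_ne_zero {ψ : ℂ → ℂ} (hψ : ∀ z ∈ Ω, deriv ψ z ≠ 0) :
    DifferentiableOn ℂ ψ Ω := fun z hz =>
  (differentiableAt_of_deriv_ne_zero (hψ z hz)).differentiableWithinAt

theorem derivative_algebraMap_apply (c : ℂ) (z : Ω) :
    (derivative (algebraMap ℂ (analyticSubalgebra Ω) c)).1 z = 0 :=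
  (extendZero_eventuallyEq (F := fun _ => c) (fun _ => rfl) z).deriv_eq.trans (deriv_const _ _)

theorem derivative_mul_apply (f g : analyticSubalgebra Ω) (z : Ω) :
    (derivative (f * g)).1 z = (derivative f).1 z * g.1 z + f.1 z * (derivative g).1 z := by
  rw [derivative_mul]
  rfl

theorem derivative_sub_apply (f g : analyticSubalgebra Ω) (z : Ω) :
    (derivative (f - g)).1 z = (derivative f).1 z - (derivative g).1 z := by
  rw [derivative_sub]
  rfl

/-- The quotient of the difference quotients of `f` and `ψ` at `p` is analytic: that of `ψ` vanishes
neither off `p`, by injectivity, nor at `p`, where it is `ψ'(p)`. -/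
theorem exists_eq_sub_mul_of_apply_eq_zero {ψ : ℂ → ℂ} (hinj : Set.InjOn ψ Ω)
    (hψ : ∀ z ∈ Ω, deriv ψ z ≠ 0) (hd : DifferentiableOn ℂ ψ Ω) (p : Ω)
    {f : analyticSubalgebra Ω} (hf : f.1 p = 0) :
    ∃ g, f = (ofDifferentiableOn ψ hd - algebraMap ℂ _ (ψ p)) * g := by
  have hp : (Ω : Set ℂ) ∈ 𝓝 (p : ℂ) := Ω.isOpen.mem_nhds p.2
  have hne : ∀ z ∈ Ω, dslope ψ p z ≠ 0 := by
    intro z hz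
    by_cases h : z = p
    · rw [h, dslope_same]
      exact hψ p p.2
    · intro h0
      have := sub_smul_dslope ψ (p : ℂ) z
      rw [h0, smul_zero] at this
      exact h (hinj hz p.2 (sub_eq_zero.1 this.symm))
  refine ⟨ofDifferentiableOn (fun z => dslope (extendZero Ω f.1) p z / dslope ψ p z)
    (((Complex.differentiableOn_dslope hp).2 (differentiableOn_extendZero f)).div
      ((Complex.differentiableOn_dslope hp).2 hd) hne), ext_apply fun z => ?_⟩
  rw [mul_apply, sub_algebraMap_apply, ofDifferentiableOn_apply, ofDifferentiableOn_apply,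
    ← sub_smul_dslope ψ (p : ℂ) z, smul_eq_mul, mul_assoc, mul_div_cancel₀ _ (hne z z.2),
    ← smul_eq_mul, sub_smul_dslope, extendZero_apply, extendZero_apply, hf, sub_zero]

theorem eq_zero_of_sub_mul_eq_zero {ψ : ℂ → ℂ} (hinj : Set.InjOn ψ Ω)
    (hψ : ∀ z ∈ Ω, deriv ψ z ≠ 0) (hd : DifferentiableOn ℂ ψ Ω) (p : Ω)
    {g : analyticSubalgebra Ω}
    (hg : (ofDifferentiableOn ψ hd - algebraMap ℂ _ (ψ p)) * g = 0) : g = 0 := by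
  refine ext_apply fun z => ?_
  change g.1 z = 0
  by_cases h : z = p
  -- At `p` the factor `ψ - ψ p` vanishes, so the product is differentiated: its derivative there is
  -- `ψ'(p) * g(p)`.
  · have h1 : (derivative ((ofDifferentiableOn ψ hd - algebraMap ℂ _ (ψ p)) * g)).1 z = 0 := by
      rw [hg, ← map_zero (algebraMap ℂ (analyticSubalgebra Ω)), derivative_algebraMap_apply]
    rw [derivative_mul_apply, derivative_sub_apply, derivative_algebraMap_apply,
      derivative_ofDifferentiableOn_apply, sub_algebraMap_apply, ofDifferentiableOn_apply, h,
      sub_self, zero_mul, add_zero, sub_zero] at h1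
    rw [h]
    exact (mul_eq_zero.1 h1).resolve_left (hψ p p.2)
  · have h1 : (ψ z - ψ p) * g.1 z = 0 := congrArg (fun f : analyticSubalgebra Ω => f.1 z) hg
    exact (mul_eq_zero.1 h1).resolve_left fun h0 =>
      h (Subtype.ext (hinj z.2 p.2 (sub_eq_zero.1 h0)))

/-- By the inverse function theorem, `ψ` maps neighbourhoods of `p` onto neighbourhoods of `ψ p`. -/
theorem nonempty_interior_range {ψ : ℂ → ℂ} (hψ : ∀ z ∈ Ω, deriv ψ z ≠ 0)
    (hd : DifferentiableOn ℂ ψ Ω) (p : Ω) :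
    (interior (Set.range (ofDifferentiableOn ψ hd).1)).Nonempty := by
  refine ⟨ψ p, mem_interior_iff_mem_nhds.2 ?_⟩
  have hs := (hd.analyticOnNhd Ω.isOpen p p.2).hasStrictDerivAt
  rw [← hs.map_nhds_eq (hψ p p.2)]
  filter_upwards [image_mem_map (Ω.isOpen.mem_nhds p.2)]
  rintro _ ⟨z, hz, rfl⟩
  exact ⟨⟨z, hz⟩, rfl⟩

end AnalyticFunctions

/-! ### Algebraic determination of the Lie ring of analytic functions. -/

namespace AnalyticLieRing

open AnalyticFunctions

/-- The analytic function underlying an element of `𝒜(Ω)`. -/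
def toAnalytic {Ω : Opens ℂ} (f : AnalyticLieRing Ω) : analyticSubalgebra Ω := f

/-- Evaluations are continuous for every Polish Lie ring topology on `𝒜(Ω)`, provided that `Ω`
carries a bounded univalent function. -/
theorem continuous_apply_of_lieEquiv {Ω : Opens ℂ} (hΩ : IsPreconnected (Ω : Set ℂ)) {ψ : ℂ → ℂ}
    (hbdd : Bornology.IsBounded (ψ '' Ω)) (hinj : Set.InjOn ψ Ω) (hψ : ∀ z ∈ Ω, deriv ψ z ≠ 0)
    {S : Type*} [LieRing S] [TopologicalSpace S] [IsPolishLieRing S]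
    (φ : S ≃ₗ⁅ℤ⁆ AnalyticLieRing Ω) (p : Ω) :
    Continuous fun s => (φ s).toAnalytic.1 p := by
  have hd := differentiableOn_of_deriv_ne_zero hψ
  have hu : IsUnit (derivative (ofDifferentiableOn ψ hd)) := isUnit_of_forall_ne_zero fun z => by
    rw [derivative_ofDifferentiableOn_apply]
    exact hψ z z.2
  have : Nontrivial (analyticSubalgebra Ω) := (evalAlgHom p).toRingHom.domain_nontrivial
  obtain ⟨e, heφ, hlie⟩ : ∃ e : S ≃+ analyticSubalgebra Ω, (∀ s, e s = (φ s).toAnalytic) ∧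
      ∀ s t, e ⁅s, t⁆ = e s * derivative (e t) - derivative (e s) * e t :=
    ⟨{ toFun := φ
       invFun := φ.symm
       left_inv := φ.symm_apply_apply
       right_inv := φ.apply_symm_apply
       map_add' := map_add φ }, fun _ => rfl, fun s t => φ.map_lie s t⟩
  have hb : Continuous fun q : S × S =>
      e.symm (e q.1 * derivative (e q.2) - derivative (e q.1) * e q.2) :=
    (IsPolishLieRing.continuous_bracket (L := S)).congr fun q => by
      rw [← hlie, AddEquiv.symm_apply_apply]
  have hbdd' : Bornology.IsBounded (spectrum ℂ (ofDifferentiableOn ψ hd)) := by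
    rw [spectrum_eq_range]
    refine hbdd.subset ?_
    rintro _ ⟨z, rfl⟩
    exact ⟨z, z.2, rfl⟩
  have hint : (interior (spectrum ℂ (ofDifferentiableOn ψ hd))).Nonempty := by
    rw [spectrum_eq_range]
    exact nonempty_interior_range hψ hd p
  have key := @AddEquiv.continuous_algHom_of_isUnit S (analyticSubalgebra Ω) inferInstance
    inferInstance inferInstance inferInstance inferInstance inferInstance inferInstance
  simp only [← heφ]
  exact key e derivative (fun f g => derivative_add f g) (fun c f => derivative_smul c f)
    (fun f g => derivative_mul f g) hb hu
    (fun f hf => exists_algebraMap_eq_of_derivative_eq_zero hΩ hf) hbdd' hint (evalAlgHom p)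
    (fun f hf => exists_eq_sub_mul_of_apply_eq_zero hinj hψ hd p hf)
    (fun g hg => eq_zero_of_sub_mul_eq_zero hinj hψ hd p hg)

theorem isAlgebraicallyDetermined {Ω : Opens ℂ} (hΩ : IsSimplyConnected (Ω : Set ℂ))
    (hne : (Ω : Set ℂ) ≠ Set.univ) :
    IsAlgebraicallyDeterminedPolishLieRing.{u} (AnalyticLieRing Ω) where
  isPolishLieRing := isPolishLieRing Ω
  isHomeomorph S _ _ _ φ := by
    obtain ⟨ψ, hbdd, hinj, hψ⟩ := exists_isBounded_image_injOn_deriv_ne_zero Ω.isOpen hΩ hne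
    have hev := continuous_apply_of_lieEquiv hΩ.isPathConnected.isConnected.isPreconnected
      hbdd hinj hψ φ
    let e : S ≃+ AnalyticLieRing Ω := φ.toLinearEquiv.toAddEquiv
    -- Evaluations separate functions and are continuous for both topologies, so the graph is an
    -- intersection of closed sets.
    have hgraph : IsClosed (e.toAddMonoidHom.graph : Set (S × AnalyticLieRing Ω)) := by
      have : (e.toAddMonoidHom.graph : Set (S × AnalyticLieRing Ω)) = ⋂ p : Ω,
          {q | (φ q.1).toAnalytic.1 p =
            q.2.toAnalytic.1 p} := by
        ext q
        simp only [Set.mem_iInter]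
        exact ⟨fun h p => congrArg (fun f : analyticSubalgebra Ω => f.1 p) h, fun h => ext_apply h⟩
      rw [this]
      exact isClosed_iInter fun p => isClosed_eq ((hev p).comp continuous_fst)
        ((continuous_apply p).comp continuous_snd)
    have he : Continuous e := AddSubgroup.continuous_of_isClosed_of_forall_mem hgraph
      (fun k hk => hk.symm.trans (map_zero e)) fun s => rfl
    exact (Homeomorph.mk e.toEquiv he (e.continuous_symm_of_polishSpace he)).isHomeomorph

end AnalyticLieRing

theorem isSimplyConnected_unitDisk : IsSimplyConnected (unitDisk : Set ℂ) := by
  have : ContractibleSpace (Metric.ball (0 : ℂ) 1) :=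
    (convex_ball (0 : ℂ) 1).contractibleSpace ⟨0, Metric.mem_ball_self one_pos⟩
  exact SimplyConnectedSpace.ofContractible (Metric.ball (0 : ℂ) 1)

theorem unitDisk_ne_univ : (unitDisk : Set ℂ) ≠ Set.univ := fun h => by
  have h1 : (1 : ℂ) ∈ (unitDisk : Set ℂ) := h ▸ Set.mem_univ _
  exact absurd (mem_ball_zero_iff.1 h1) (by simp)

theorem mainTheorem6 :
    (∀ Ω : Opens ℂ, IsSimplyConnected (Ω : Set ℂ) → (Ω : Set ℂ) ≠ Set.univ →
      IsAlgebraicallyDeterminedPolishLieRing.{u} (AnalyticLieRing Ω)) ∧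
    IsAlgebraicallyDeterminedPolishLieRing.{u} (AnalyticLieRing unitDisk) :=
  ⟨fun _ hΩ hne => AnalyticLieRing.isAlgebraicallyDetermined hΩ hne,
    AnalyticLieRing.isAlgebraicallyDetermined isSimplyConnected_unitDisk unitDisk_ne_univ⟩
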